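/- **Theorem (Second alternative definition of $\Omega_K$).** Let $n\ge 2$ and let $K\subset\mathbb R^n$ be a convex body containing the origin in its interior, of class $C^2_+$ (its boundary is a $C^2$ hypersurface with everywhere positive Gauss curvature). Let $h_K(u)=\max_{x\in K}x\cdot u$ be its support function, $K^\circ=\{y: x\cdot y\le 1\ \forall x\in K\}$ its polar body, and $\kappa(u)$ the Gauss curvature of $\partial K$ at the point with outer unit normal $u\in\mathbb S^{n-1}$. Put $\kappa_0=\kappa/h_K^{\,n+1}$ (centro-affine curvature) and $d\mu_K=h_K\,\kappa^{-1}\,d\sigma$, where $\sigma$ is the surface measure of $\mathbb S^{n-1}$ (cone measure, of total mass $n\,\mathrm{Vol}(K)$). For real $p\neq -n$ let $$\Omega_p(K)=\int_{\mathbb S^{n-1}}\kappa_0^{\frac{p}{n+p}}\,d\mu_K ,\qquad \Omega_K=\lim_{p\to+\infty}\left(\frac{\Omega_p(K)}{n\,\mathrm{Vol}(K^\circ)}\right)^{n+p}.$$ The limits defining $\Omega_K$ and $\Omega_{K^\circ}$ exist and are positive. The sequences $\left(\frac{\Omega_{-(n+2^p)}(K)}{n\,\mathrm{Vol}(K^\circ)}\right)^{2^p}$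 and $\left(\frac{\Omega_{-(n+2^p)}(K^\circ)}{n\,\mathrm{Vol}(K)}\right)^{2^p}$, $p\in\mathbb N$, $p\ge1$, converge, and $$\lim_{p\to\infty}\left(\frac{\Omega_{-(n+2^p)}(K)}{n\,\mathrm{Vol}(K^\circ)}\right)^{2^p}=\Omega_K^{-1},\qquad \lim_{p\to\infty}\left(\frac{\Omega_{-(n+2^p)}(K^\circ)}{n\,\mathrm{Vol}(K)}\right)^{2^p}=\Omega_{K^\circ}^{-1}.$$ -/

import Mathlib

open Filter Topology MeasureTheory

namespace AffineInvariants

/-- Euclidean space of dimension `n`. -/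
abbrev E (n : ℕ) : Type := EuclideanSpace ℝ (Fin n)

/-- The unit sphere of `E n`. -/
abbrev S (n : ℕ) : Type := Metric.sphere (0 : E n) 1

/-- Volume of a set, as a real number. -/
noncomputable def vol {n : ℕ} (K : Set (E n)) : ℝ := (volume K).toReal

/-- Support function `h(u) = max {x · u | x ∈ K}`. -/
noncomputable def supportFn {n : ℕ} (K : Set (E n)) (u : E n) : ℝ :=
  sSup ((fun x : E n => inner ℝ x u) '' K)

/-- The polar body `K° = {y | x · y ≤ 1 for all x ∈ K}`. -/
def polarBody {n : ℕ} (K : Set (E n)) : Set (E n) :=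
  {y | ∀ x ∈ K, inner ℝ x y ≤ 1}

/-- The outer unit normal field `∇g / |∇g|`, where `g` is the gauge of `K`, so that `K = {g ≤ 1}`
and `∂K = {g = 1}` when `0` is an interior point. On `∂K` this is the Gauss map `ν : ∂K → S`.
(It is defined off `∂K` too, where it is constant along rays from the origin.) -/
noncomputable def gaussMap {n : ℕ} (K : Set (E n)) (x : E n) : E n :=
  ‖gradient (gauge K) x‖⁻¹ • gradient (gauge K) x

/-- The shape operator (differential of the Gauss map) at `x ∈ ∂K`, as an endomorphism of the
tangent space `T_x ∂K = ν(x)ᗮ`. -/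
noncomputable def shapeOperator {n : ℕ} (K : Set (E n)) (x : E n) :
    (Submodule.span ℝ {gaussMap K x})ᗮ →ₗ[ℝ] (Submodule.span ℝ {gaussMap K x})ᗮ :=
  ((Submodule.span ℝ {gaussMap K x})ᗮ.orthogonalProjectionOnto ∘L
    (fderiv ℝ (gaussMap K) x ∘L (Submodule.span ℝ {gaussMap K x})ᗮ.subtypeL)).toLinearMap

/-- Gauss curvature of `∂K` at the boundary point `x`. -/
noncomputable def gaussCurvatureAt {n : ℕ} (K : Set (E n)) (x : E n) : ℝ :=
  LinearMap.det (shapeOperator K x)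

/-- Convex bodies of class `C²₊` with the origin in the interior. As the origin is an interior
point, `∂K = {g = 1}` is a `C²` hypersurface exactly when the gauge `g` is `C²` away from `0`
(rays from the origin are transversal to `∂K`). -/
structure IsC2Plus {n : ℕ} (K : Set (E n)) : Prop where
  convex : Convex ℝ K
  isCompact : IsCompact K
  zero_mem_interior : (0 : E n) ∈ interior K
  contDiffOn_gauge : ContDiffOn ℝ 2 (gauge K) {0}ᶜ
  gaussCurvature_pos : ∀ x ∈ frontier K, 0 < gaussCurvatureAt K x

/-- The parametrization `X_K : S → ∂K` by the outer unit normal: the inverse of the Gauss map. -/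
noncomputable def normalParam {n : ℕ} (K : Set (E n)) (u : S n) : E n :=
  Function.invFunOn (gaussMap K) (frontier K) (u : E n)

/-- Gauss curvature as a function of the outer unit normal. -/
noncomputable def gaussCurvature {n : ℕ} (K : Set (E n)) (u : S n) : ℝ :=
  gaussCurvatureAt K (normalParam K u)

/-- Centro-affine curvature `κ₀(u) = κ(u) / h(u)^(n+1)`. -/
noncomputable def centroAffineCurvature {n : ℕ} (K : Set (E n)) (u : S n) : ℝ :=
  gaussCurvature K u / supportFn K (u : E n) ^ (n + 1)

/-- The cone measure of `∂K` (of total mass `n Vol K`), transported to the sphere by the Gauss map: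
`dμ_K = h κ⁻¹ dσ`, with `σ` the surface measure of the unit sphere. -/
noncomputable def coneMeasure {n : ℕ} (K : Set (E n)) : Measure (S n) :=
  (volume : Measure (E n)).toSphere.withDensity
    (fun u => ENNReal.ofReal (supportFn K (u : E n) / gaussCurvature K u))

/-- The `p`-affine surface area `Ω_p(K) = ∫ κ₀^(p/(n+p)) dμ_K`, for real `p ≠ -n`. -/
noncomputable def affineSurfaceArea {n : ℕ} (p : ℝ) (K : Set (E n)) : ℝ :=
  ∫ u, centroAffineCurvature K u ^ (p / ((n : ℝ) + p)) ∂(coneMeasure K)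

/-- The function of `p` whose limit at `+∞` is the Paouris-Werner invariant. -/
noncomputable def paourisWernerSeq {n : ℕ} (K : Set (E n)) (p : ℝ) : ℝ :=
  (affineSurfaceArea p K / ((n : ℝ) * vol (polarBody K))) ^ ((n : ℝ) + p)

/-- The Paouris-Werner invariant `Ω_K = lim_{p → ∞} (Ω_p(K) / (n Vol K°))^(n+p)`. -/
noncomputable def paourisWerner {n : ℕ} (K : Set (E n)) : ℝ :=
  limUnder atTop (paourisWernerSeq K)

end AffineInvariants

/-!
Write `g` for the gauge of `K`, `h` for its support function, and `q = n + p`. Since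
`κ₀ dμ_K = h⁻ⁿ dσ`, the `p`-affine surface area is the moment `∫ κ₀ ^ (-n / q) h⁻ⁿ dσ`
(`IsC2Plus.affineSurfaceArea_eq`), and `∫ h⁻ⁿ dσ = n Vol(K°)` by integration in polar coordinates
(`IsC2Body.integral_supportFn`). Hence `Ω_p(K) / (n Vol(K°)) = ψ (-n / q)`, where `ψ s` is the moment
of order `s` of `κ₀` for a probability measure. As `s → 0` with either sign, `ψ s ^ (1 / s)` tends
to the geometric mean `ℓ` of `κ₀` (`tendsto_rpow_inv_of_hasDerivAt`). The sequence that defines `Ω_K`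
is `(ψ s ^ (1 / s)) ^ (-n)` along `s = -n / q → 0`, and the sequence with `p` replaced by
`-(n + 2 ^ p)` is `(ψ s ^ (1 / s)) ^ n` along `s = n / 2 ^ p → 0`. So `Ω_K = ℓ⁻ⁿ > 0`, and the second
limit is its inverse (`IsC2Plus.exists_tendsto_paourisWernerSeq`).

This uses that `κ₀` is a positive continuous function on the sphere. The Gauss map is injective, as
a segment in the boundary would be a direction of zero curvature (`IsC2Plus.eq_of_gradient_eq`), so
it is a homeomorphism from `∂K` to the sphere. The curvature is continuous on `∂K`, as the
determinant of the shape operator equals that of an endomorphism of the whole space depending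
continuously on the point (`det_compression_eq`).

The statement for `K°` is the one for a body of class `C²₊` again (`IsC2Plus.isC2Plus_polarBody`).
The gauge of `K°` is `h`, and the map `h ∇h` is inverse to the map `g ∇g`, which is `C¹` with
injective derivative away from `0` because the curvature is positive. By the inverse function
theorem `h` is `C²` away from `0`, with nondegenerate Hessian transversally to rays. Finally
`K°° = K` (`IsC2Body.polarBody_polarBody`).
-/

namespace AffineInvariants

variable {n : ℕ} {K : Set (E n)} {x y z a v w : E n}

/-! ### The gauge and its Hessian -/

/-- A linear functional below a function that touches it at `x` is its gradient at `x`. -/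
theorem gradient_eq_of_touching {f : E n → ℝ} (hf : DifferentiableAt ℝ f x)
    (hle : ∀ z, inner ℝ a z ≤ f z) (heq : inner ℝ a x = f x) : gradient f x = a := by
  have hg := hf.hasFDerivAt
  have ha : HasFDerivAt (fun z => inner ℝ a z) (innerSL ℝ a) x := (innerSL ℝ a).hasFDerivAt
  have hmin : IsLocalMin (fun z => f z - inner ℝ a z) x :=
    Eventually.of_forall fun z => by simp only [heq, sub_self, sub_nonneg]; exact hle z
  have h0 := hmin.hasFDerivAt_eq_zero (hg.sub ha)
  refine ext_inner_right ℝ fun v => ?_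
  have := congrArg (fun f => f v) h0
  simp only [sub_apply, zero_apply, innerSL_apply_apply]
    at this
  rw [inner_gradient_left]
  linarith

/-- A convex body with the origin in its interior whose boundary is a `C²` hypersurface, without
any assumption on its curvature. -/
structure IsC2Body (K : Set (E n)) : Prop where
  convex : Convex ℝ K
  isCompact : IsCompact K
  zero_mem_interior : (0 : E n) ∈ interior K
  contDiffOn_gauge : ContDiffOn ℝ 2 (gauge K) {0}ᶜ

theorem IsC2Plus.isC2Body (hK : IsC2Plus K) : IsC2Body K :=
  ⟨hK.convex, hK.isCompact, hK.zero_mem_interior, hK.contDiffOn_gauge⟩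

namespace IsC2Body

theorem mem_nhds_zero (hK : IsC2Body K) : K ∈ 𝓝 (0 : E n) :=
  mem_interior_iff_mem_nhds.1 hK.zero_mem_interior

theorem absorbent (hK : IsC2Body K) : Absorbent ℝ K :=
  absorbent_nhds_zero hK.mem_nhds_zero

theorem gauge_add_le (hK : IsC2Body K) (x y : E n) : gauge K (x + y) ≤ gauge K x + gauge K y :=
  _root_.gauge_add_le hK.convex hK.absorbent x y

theorem gauge_smul {t : ℝ} (ht : 0 ≤ t) (x : E n) : gauge K (t • x) = t * gauge K x :=
  gauge_smul_of_nonneg ht x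

theorem gauge_pos (hK : IsC2Body K) (hx : x ≠ 0) : 0 < gauge K x :=
  (_root_.gauge_pos hK.absorbent
    (NormedSpace.isVonNBounded_of_isBounded ℝ hK.isCompact.isBounded)).2 hx

theorem continuous_gauge (hK : IsC2Body K) : Continuous (gauge K) :=
  _root_.continuous_gauge hK.convex hK.mem_nhds_zero

theorem mem_frontier_iff (hK : IsC2Body K) : x ∈ frontier K ↔ gauge K x = 1 :=
  (gauge_eq_one_iff_mem_frontier hK.convex hK.mem_nhds_zero).symm

theorem mem_iff (hK : IsC2Body K) : x ∈ K ↔ gauge K x ≤ 1 := by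
  rw [gauge_le_one_iff_mem_closure hK.convex hK.mem_nhds_zero, hK.isCompact.isClosed.closure_eq]

theorem ne_zero_of_mem_frontier (hK : IsC2Body K) (hx : x ∈ frontier K) : x ≠ 0 := by
  rintro rfl
  simp [hK.mem_frontier_iff] at hx

theorem isCompact_frontier (hK : IsC2Body K) : IsCompact (frontier K) :=
  hK.isCompact.of_isClosed_subset isClosed_frontier hK.isCompact.isClosed.frontier_subset

theorem contDiffAt_gauge (hK : IsC2Body K) (hx : x ≠ 0) : ContDiffAt ℝ 2 (gauge K) x :=
  hK.contDiffOn_gauge.contDiffAt (isOpen_compl_singleton.mem_nhds hx)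

theorem differentiableAt_gauge (hK : IsC2Body K) (hx : x ≠ 0) :
    DifferentiableAt ℝ (gauge K) x :=
  (hK.contDiffAt_gauge hx).differentiableAt (by norm_num)

theorem inner_gradient_le (hK : IsC2Body K) (hx : x ≠ 0) (z : E n) :
    inner ℝ (gradient (gauge K) x) z ≤ gauge K z := by
  rw [inner_gradient_left]
  have hg := (hK.differentiableAt_gauge hx).hasFDerivAt
  have hl := hg.hasLineDerivAt z
  have ht := (hl.tendsto_slope_zero_right)
  refine le_of_tendsto ht ?_
  filter_upwards [self_mem_nhdsWithin] with t ht
  have ht : 0 < t := ht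
  have h1 := hK.gauge_add_le x (t • z)
  rw [gauge_smul ht.le] at h1
  simp only [smul_eq_mul]
  rw [inv_mul_le_iff₀ ht]
  linarith

theorem inner_gradient_self (hK : IsC2Body K) (hx : x ≠ 0) :
    inner ℝ (gradient (gauge K) x) x = gauge K x := by
  refine le_antisymm (hK.inner_gradient_le hx x) ?_
  rw [inner_gradient_left]
  have hl := (hK.differentiableAt_gauge hx).hasFDerivAt.hasLineDerivAt x
  refine ge_of_tendsto (hl.tendsto_slope_zero_right) ?_
  filter_upwards [self_mem_nhdsWithin] with t ht
  have ht : 0 < t := ht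
  have h1 : x + t • x = (1 + t) • x := by rw [add_smul, one_smul]
  simp only [smul_eq_mul]
  rw [h1, gauge_smul (by linarith), le_inv_mul_iff₀ ht]
  linarith

theorem gradient_ne_zero (hK : IsC2Body K) (hx : x ≠ 0) : gradient (gauge K) x ≠ 0 := by
  intro h
  have := hK.inner_gradient_self hx
  rw [h, inner_zero_left] at this
  exact (hK.gauge_pos hx).ne this

theorem gradient_smul (hK : IsC2Body K) (hx : x ≠ 0) {t : ℝ} (ht : 0 < t) :
    gradient (gauge K) (t • x) = gradient (gauge K) x := by
  refine gradient_eq_of_touching (hK.differentiableAt_gauge (smul_ne_zero ht.ne' hx))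
    (hK.inner_gradient_le hx) ?_
  rw [inner_smul_right, hK.inner_gradient_self hx, gauge_smul ht.le]

theorem contDiffAt_gradient (hK : IsC2Body K) (hx : x ≠ 0) :
    ContDiffAt ℝ 1 (gradient (gauge K)) x := by
  have h1 : ContDiffAt ℝ 1 (fderiv ℝ (gauge K)) x :=
    (hK.contDiffAt_gauge hx).fderiv_right (by norm_num)
  exact ((InnerProductSpace.toDual ℝ (E n)).symm.contDiff.contDiffAt).comp x h1

theorem differentiableAt_gradient (hK : IsC2Body K) (hx : x ≠ 0) :
    DifferentiableAt ℝ (gradient (gauge K)) x :=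
  (hK.contDiffAt_gradient hx).differentiableAt (by norm_num)

theorem inner_fderiv_gradient (hK : IsC2Body K) (hx : x ≠ 0) (v w : E n) :
    inner ℝ (fderiv ℝ (gradient (gauge K)) x v) w = fderiv ℝ (fderiv ℝ (gauge K)) x v w := by
  have h1 : DifferentiableAt ℝ (fderiv ℝ (gauge K)) x :=
    ((hK.contDiffAt_gauge hx).fderiv_right (m := 1) (by norm_num)).differentiableAt (by norm_num)
  have h2 : HasFDerivAt (fun z => fderiv ℝ (gauge K) z w)
      ((fderiv ℝ (fderiv ℝ (gauge K)) x).flip w) x := by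
    simpa using h1.hasFDerivAt.clm_apply (hasFDerivAt_const w x)
  have h3 : HasFDerivAt (fun z => inner ℝ (gradient (gauge K) z) w)
      ((innerSL ℝ w).comp (fderiv ℝ (gradient (gauge K)) x)) x := by
    have := (innerSL ℝ w).hasFDerivAt.comp x (hK.differentiableAt_gradient hx).hasFDerivAt
    refine this.congr_of_eventuallyEq (Eventually.of_forall fun z => ?_)
    simp
  simp only [inner_gradient_left] at h3
  have := congrArg (fun f => f v) (h3.unique h2)
  simpa [real_inner_comm] using this

/-- The Hessian of the gauge is symmetric. -/
theorem inner_fderiv_gradient_comm (hK : IsC2Body K) (hx : x ≠ 0) (v w : E n) :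
    inner ℝ (fderiv ℝ (gradient (gauge K)) x v) w =
      inner ℝ v (fderiv ℝ (gradient (gauge K)) x w) := by
  rw [real_inner_comm _ v, hK.inner_fderiv_gradient hx, hK.inner_fderiv_gradient hx]
  exact (hK.contDiffAt_gauge hx).isSymmSndFDerivAt (by simp) v w

/-- The radial direction lies in the kernel of the Hessian, since the gradient is constant along
rays. -/
theorem fderiv_gradient_self (hK : IsC2Body K) (hx : x ≠ 0) :
    fderiv ℝ (gradient (gauge K)) x x = 0 := by
  have hl := (hK.differentiableAt_gradient hx).hasFDerivAt.hasLineDerivAt x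
  refine tendsto_nhds_unique (hl.tendsto_slope_zero_right) ?_
  refine tendsto_const_nhds.congr' ?_
  filter_upwards [self_mem_nhdsWithin] with t ht
  have ht : 0 < t := ht
  have h1 : x + t • x = (1 + t) • x := by rw [add_smul, one_smul]
  simp [h1, hK.gradient_smul hx (show 0 < 1 + t by linarith)]

theorem inner_fderiv_gradient_self_left (hK : IsC2Body K) (hx : x ≠ 0) (v : E n) :
    inner ℝ x (fderiv ℝ (gradient (gauge K)) x v) = 0 := by
  rw [← hK.inner_fderiv_gradient_comm hx, hK.fderiv_gradient_self hx, inner_zero_left]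

/-- The Hessian of the gauge is positive semidefinite, as the gradient of a convex function is
monotone. -/
theorem inner_fderiv_gradient_nonneg (hK : IsC2Body K) (hx : x ≠ 0) (v : E n) :
    0 ≤ inner ℝ (fderiv ℝ (gradient (gauge K)) x v) v := by
  have hl := (hK.differentiableAt_gradient hx).hasFDerivAt.hasLineDerivAt v
  have ht := Filter.Tendsto.inner (𝕜 := ℝ) hl.tendsto_slope_zero_right (tendsto_const_nhds (x := v))
  refine ge_of_tendsto ht ?_
  have hne : ∀ᶠ t : ℝ in 𝓝[>] 0, x + t • v ≠ 0 := by
    have : Tendsto (fun t : ℝ => x + t • v) (𝓝[>] 0) (𝓝 x) := by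
      have hc : Continuous (fun t : ℝ => x + t • v) := by fun_prop
      simpa using (hc.tendsto 0).mono_left nhdsWithin_le_nhds
    exact this.eventually_ne hx
  filter_upwards [self_mem_nhdsWithin, hne] with t ht hne
  have ht : 0 < t := ht
  rw [real_inner_smul_left]
  refine mul_nonneg (inv_pos.2 ht).le ?_
  have h1 := hK.inner_gradient_le hne x
  have h2 := hK.inner_gradient_self hne
  have h3 := hK.inner_gradient_le hx (x + t • v)
  have h4 := hK.inner_gradient_self hx
  simp only [inner_add_right, real_inner_smul_right] at h2 h3
  rw [inner_sub_left]
  nlinarith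

end IsC2Body

/-! ### The shape operator and the Gauss curvature -/

/-- The extension of the compression of `N` to `νᗮ` by the identity on the line spanned by `ν`.
It has the same determinant as the compression, but acts on a space that does not depend on `ν`. -/
noncomputable def extendedCompression (ν : E n) (N : E n →L[ℝ] E n) : E n →L[ℝ] E n :=
  let P : E n →L[ℝ] E n := ContinuousLinearMap.id ℝ (E n) - (innerSL ℝ ν).smulRight ν
  P ∘L N ∘L P + (innerSL ℝ ν).smulRight ν

theorem extendedCompression_apply (ν : E n) (N : E n →L[ℝ] E n) (v : E n) :
    extendedCompression ν N v = N (v - inner ℝ ν v • ν) -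
      inner ℝ ν (N (v - inner ℝ ν v • ν)) • ν + inner ℝ ν v • ν := by
  simp [extendedCompression, inner_sub_right, real_inner_smul_right, sub_smul, mul_smul]
  abel

theorem det_compression_eq {ν : E n} (hν : ‖ν‖ = 1) (N : E n →L[ℝ] E n) :
    LinearMap.det ((Submodule.span ℝ {ν})ᗮ.orthogonalProjectionOnto ∘L
      (N ∘L (Submodule.span ℝ {ν})ᗮ.subtypeL)).toLinearMap = (extendedCompression ν N).det := by
  set W := (Submodule.span ℝ {ν})ᗮ with hW
  have hmem : ∀ {v}, v ∈ W ↔ inner ℝ ν v = 0 := Submodule.mem_orthogonal_singleton_iff_inner_right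
  have hinv : W ≤ W.comap (extendedCompression ν N).toLinearMap := fun v hv => by
    simp only [Submodule.mem_comap, ContinuousLinearMap.coe_coe]
    rw [hmem, extendedCompression_apply]
    simp [inner_sub_right, real_inner_smul_right, hν, hmem.1 hv]
  have hres : (extendedCompression ν N).toLinearMap.restrict hinv =
      (W.orthogonalProjectionOnto ∘L (N ∘L W.subtypeL)).toLinearMap := by
    ext v : 2
    simp [hW, Submodule.starProjection_unit_singleton ℝ hν, LinearMap.restrict_apply,
      extendedCompression_apply, hmem.1 v.2]
  have hquot : W.mapQ W (extendedCompression ν N).toLinearMap hinv = LinearMap.id := by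
    refine Submodule.linearMap_qext _ ?_
    ext1 v
    simp only [LinearMap.comp_apply, Submodule.mkQ_apply, Submodule.mapQ_apply, LinearMap.id_apply,
      ContinuousLinearMap.coe_coe]
    rw [Submodule.Quotient.eq, hmem, extendedCompression_apply]
    simp [inner_sub_right, inner_add_right, real_inner_smul_right, hν]
  rw [ContinuousLinearMap.det, LinearMap.det_eq_det_mul_det W _ hinv, hres, hquot,
    LinearMap.det_id, mul_one]

namespace IsC2Body

theorem norm_gaussMap (hK : IsC2Body K) (hx : x ≠ 0) : ‖gaussMap K x‖ = 1 := by
  simp [gaussMap, norm_smul, hK.gradient_ne_zero hx]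

theorem contDiffAt_gaussMap (hK : IsC2Body K) (hx : x ≠ 0) : ContDiffAt ℝ 1 (gaussMap K) x := by
  have h := hK.contDiffAt_gradient hx
  have h0 := hK.gradient_ne_zero hx
  exact ((h.norm ℝ h0).inv (norm_ne_zero_iff.2 h0)).smul h

/-- Modulo the normal direction, the differential of the Gauss map is a positive multiple of the
Hessian of the gauge. -/
theorem inner_fderiv_gaussMap (hK : IsC2Body K) (hx : x ≠ 0) (v : E n)
    (hw : inner ℝ (gaussMap K x) w = 0) :
    inner ℝ (fderiv ℝ (gaussMap K) x v) w =
      ‖gradient (gauge K) x‖⁻¹ * inner ℝ (fderiv ℝ (gradient (gauge K)) x v) w := by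
  have h := hK.contDiffAt_gradient hx
  have h0 := hK.gradient_ne_zero hx
  have hs : DifferentiableAt ℝ (fun z => ‖gradient (gauge K) z‖⁻¹) x :=
    ((h.norm ℝ h0).inv (norm_ne_zero_iff.2 h0)).differentiableAt (by norm_num)
  have hd : HasFDerivAt (gaussMap K) _ x :=
    hs.hasFDerivAt.smul (hK.differentiableAt_gradient hx).hasFDerivAt
  have hw' : inner ℝ (gradient (gauge K) x) w = 0 := by
    simpa [gaussMap, real_inner_smul_left, h0] using hw
  rw [hd.fderiv]
  simp [inner_add_left, real_inner_smul_left, hw']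

theorem inner_shapeOperator (hK : IsC2Body K) (hx : x ≠ 0)
    (v w : (Submodule.span ℝ {gaussMap K x})ᗮ) :
    inner ℝ (shapeOperator K x v) w = ‖gradient (gauge K) x‖⁻¹ *
      inner ℝ (fderiv ℝ (gradient (gauge K)) x (v : E n)) (w : E n) := by
  have hw := Submodule.mem_orthogonal_singleton_iff_inner_right.1 w.2
  rw [← hK.inner_fderiv_gaussMap hx _ hw]
  simp [shapeOperator]

theorem isPositive_shapeOperator (hK : IsC2Body K) (hx : x ≠ 0) :
    (shapeOperator K x).IsPositive := by
  refine ⟨fun v w => ?_, fun v => ?_⟩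
  · rw [hK.inner_shapeOperator hx, ← real_inner_comm v, hK.inner_shapeOperator hx,
      hK.inner_fderiv_gradient_comm hx, real_inner_comm]
  · rw [hK.inner_shapeOperator hx]
    exact mul_nonneg (by positivity) (hK.inner_fderiv_gradient_nonneg hx _)

theorem gaussCurvatureAt_nonneg (hK : IsC2Body K) (hx : x ≠ 0) : 0 ≤ gaussCurvatureAt K x := by
  have h := hK.isPositive_shapeOperator hx
  rw [gaussCurvatureAt, h.isSymmetric.det_eq_prod_eigenvalues rfl]
  exact Finset.prod_nonneg fun i _ => h.nonneg_eigenvalues rfl i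

/-- A tangent vector is in the kernel of the shape operator exactly if it is in the kernel of the
Hessian of the gauge: the image of the Hessian is orthogonal to the radial direction, so that it
meets the normal line only in `0`. -/
theorem shapeOperator_eq_zero_iff (hK : IsC2Body K) (hx : x ≠ 0)
    (v : (Submodule.span ℝ {gaussMap K x})ᗮ) :
    shapeOperator K x v = 0 ↔ fderiv ℝ (gradient (gauge K)) x (v : E n) = 0 := by
  have h0 := hK.gradient_ne_zero hx
  constructor
  · intro h
    have hperp : fderiv ℝ (gradient (gauge K)) x (v : E n) ∈
        (Submodule.span ℝ {gaussMap K x})ᗮᗮ := by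
      rw [Submodule.mem_orthogonal']
      intro w hw
      have := hK.inner_shapeOperator hx v ⟨w, hw⟩
      rw [h, inner_zero_left, eq_comm, mul_eq_zero] at this
      exact this.resolve_left (inv_ne_zero (norm_ne_zero_iff.2 h0))
    rw [Submodule.orthogonal_orthogonal, Submodule.mem_span_singleton] at hperp
    obtain ⟨c, hc⟩ := hperp
    have h1 := hK.inner_fderiv_gradient_self_left hx v
    rw [← hc, gaussMap, smul_smul, real_inner_smul_right, real_inner_comm,
      hK.inner_gradient_self hx] at h1
    have h2 := (mul_eq_zero.1 h1).resolve_right (hK.gauge_pos hx).ne'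
    rw [← hc, gaussMap, smul_smul, h2, zero_smul]
  · intro h
    refine ext_inner_right ℝ fun w => ?_
    rw [hK.inner_shapeOperator hx, h]
    simp

theorem gaussCurvatureAt_pos_iff (hK : IsC2Body K) (hx : x ≠ 0) :
    0 < gaussCurvatureAt K x ↔ ∀ v, inner ℝ (gradient (gauge K) x) v = 0 →
      fderiv ℝ (gradient (gauge K)) x v = 0 → v = 0 := by
  have h0 := hK.gradient_ne_zero hx
  have hmem : ∀ v, v ∈ (Submodule.span ℝ {gaussMap K x})ᗮ ↔
      inner ℝ (gradient (gauge K) x) v = 0 := fun v => by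
    rw [Submodule.mem_orthogonal_singleton_iff_inner_right]
    simp [gaussMap, real_inner_smul_left, h0]
  rw [(hK.gaussCurvatureAt_nonneg hx).lt_iff_ne', Ne, gaussCurvatureAt,
    LinearMap.det_eq_zero_iff_ker_ne_bot, not_not, LinearMap.ker_eq_bot']
  constructor
  · intro h v hv hv'
    have := h ⟨v, (hmem v).2 hv⟩ ((hK.shapeOperator_eq_zero_iff hx _).2 hv')
    simpa using this
  · intro h v hv
    exact Subtype.ext (h v ((hmem v).1 v.2) ((hK.shapeOperator_eq_zero_iff hx v).1 hv))

theorem continuousAt_gaussCurvatureAt (hK : IsC2Body K) (hx : x ≠ 0) :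
    ContinuousAt (gaussCurvatureAt K) x := by
  have h1 : ContinuousAt (gaussMap K) x := (hK.contDiffAt_gaussMap hx).continuousAt
  have h2 : ContinuousAt (fderiv ℝ (gaussMap K)) x :=
    ((hK.contDiffAt_gaussMap hx).fderiv_right (m := 0) (by norm_num)).continuousAt
  have h3 : ContinuousAt (fun z => (innerSL ℝ (gaussMap K z)).smulRight (gaussMap K z)) x := by
    have : Continuous fun u : E n => (innerSL ℝ u).smulRight u := by
      have : (fun u : E n => (innerSL ℝ u).smulRight u) = fun u =>
        ContinuousLinearMap.smulRightL ℝ (E n) (E n) (innerSL ℝ u) u := rfl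
      rw [this]
      fun_prop
    exact this.continuousAt.comp h1
  have h4 : ContinuousAt
      (fun z => (extendedCompression (gaussMap K z) (fderiv ℝ (gaussMap K) z)).det) x := by
    refine ContinuousLinearMap.continuous_det.continuousAt.comp ?_
    have h5 := continuousAt_const (y := ContinuousLinearMap.id ℝ (E n)) |>.sub h3
    exact (h5.clm_comp (h2.clm_comp h5)).add h3
  refine h4.congr ?_
  filter_upwards [isOpen_compl_singleton.mem_nhds hx] with z hz
  exact (det_compression_eq (hK.norm_gaussMap hz) _).symm

end IsC2Body

/-! ### Support function and Gauss map -/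

namespace IsC2Body

theorem zero_mem (hK : IsC2Body K) : (0 : E n) ∈ K := interior_subset hK.zero_mem_interior

theorem isLUB_supportFn (hK : IsC2Body K) (u : E n) :
    IsLUB ((fun x : E n => inner ℝ x u) '' K) (supportFn K u) :=
  isLUB_csSup ⟨_, 0, hK.zero_mem, rfl⟩
    (hK.isCompact.image (by fun_prop : Continuous fun x : E n => inner ℝ x u)).bddAbove

theorem inner_le_supportFn (hK : IsC2Body K) (hx : x ∈ K) (u : E n) :
    inner ℝ x u ≤ supportFn K u :=
  (hK.isLUB_supportFn u).1 ⟨x, hx, rfl⟩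

theorem supportFn_le_iff (hK : IsC2Body K) {c : ℝ} {u : E n} :
    supportFn K u ≤ c ↔ ∀ x ∈ K, inner ℝ x u ≤ c := by
  rw [isLUB_le_iff (hK.isLUB_supportFn u)]
  simp [mem_upperBounds]

theorem mem_polarBody_iff (hK : IsC2Body K) : y ∈ polarBody K ↔ supportFn K y ≤ 1 :=
  hK.supportFn_le_iff.symm

theorem inv_gauge_smul_mem_frontier (hK : IsC2Body K) (hx : x ≠ 0) :
    (gauge K x)⁻¹ • x ∈ frontier K := by
  have := hK.gauge_pos hx
  rw [hK.mem_frontier_iff, gauge_smul (inv_nonneg.2 this.le), inv_mul_cancel₀ this.ne']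

theorem frontier_subset (hK : IsC2Body K) : frontier K ⊆ K :=
  hK.isCompact.isClosed.frontier_subset

theorem inner_le_gauge_mul_supportFn (hK : IsC2Body K) (x u : E n) :
    inner ℝ x u ≤ gauge K x * supportFn K u := by
  rcases eq_or_ne x 0 with rfl | hx
  · simp
  have h1 := hK.inner_le_supportFn (hK.frontier_subset (hK.inv_gauge_smul_mem_frontier hx)) u
  rwa [real_inner_smul_left, inv_mul_le_iff₀ (hK.gauge_pos hx)] at h1

theorem supportFn_nonneg (hK : IsC2Body K) (u : E n) : 0 ≤ supportFn K u := by
  simpa using hK.inner_le_supportFn hK.zero_mem u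

theorem supportFn_pos (hK : IsC2Body K) {u : E n} (hu : u ≠ 0) : 0 < supportFn K u := by
  have h1 := hK.inner_le_gauge_mul_supportFn u u
  have h2 : (0 : ℝ) < inner ℝ u u := real_inner_self_pos.2 hu
  exact pos_of_mul_pos_right (h2.trans_le h1) (gauge_nonneg u)

theorem gauge_polarBody (hK : IsC2Body K) : gauge (polarBody K) = supportFn K := by
  ext y
  rcases eq_or_ne y 0 with rfl | hy
  · rw [gauge_zero]
    exact le_antisymm (hK.supportFn_nonneg 0) (hK.supportFn_le_iff.2 (by simp))
  have hset : {r ∈ Set.Ioi (0 : ℝ) | r⁻¹ • y ∈ polarBody K} = Set.Ici (supportFn K y) := by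
    ext r
    constructor
    · rintro ⟨hr, h⟩
      refine hK.supportFn_le_iff.2 fun x hx => ?_
      have h1 : inner ℝ x (r⁻¹ • y) ≤ 1 := h x hx
      rwa [real_inner_smul_right, inv_mul_le_iff₀ hr, mul_one] at h1
    · intro h
      have hr : 0 < r := (hK.supportFn_pos hy).trans_le h
      refine ⟨hr, fun x hx => ?_⟩
      rw [real_inner_smul_right, inv_mul_le_iff₀ hr, mul_one]
      exact hK.supportFn_le_iff.1 h x hx
  rw [gauge_def', hset, csInf_Ici]

theorem supportFn_smul (hK : IsC2Body K) {t : ℝ} (ht : 0 ≤ t) (u : E n) :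
    supportFn K (t • u) = t * supportFn K u := by
  rw [← hK.gauge_polarBody, gauge_smul ht]

theorem supportFn_gradient (hK : IsC2Body K) (hx : x ≠ 0) :
    supportFn K (gradient (gauge K) x) = 1 := by
  refine le_antisymm (hK.supportFn_le_iff.2 fun z hz => ?_) ?_
  · rw [real_inner_comm]
    exact (hK.inner_gradient_le hx z).trans (hK.mem_iff.1 hz)
  · have h1 := hK.inner_le_gauge_mul_supportFn x (gradient (gauge K) x)
    rw [real_inner_comm, hK.inner_gradient_self hx] at h1
    exact (le_mul_iff_one_le_right (hK.gauge_pos hx)).1 h1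

/-- The direction `u` is normal to `∂K` at the point where `⟪·, u⟫` attains its maximum. -/
theorem exists_supportFn_smul_gradient (hK : IsC2Body K) {u : E n} (hu : u ≠ 0) :
    ∃ z ∈ frontier K, supportFn K u • gradient (gauge K) z = u := by
  obtain ⟨z, hz, hmax⟩ := hK.isCompact.exists_isMaxOn ⟨0, hK.zero_mem⟩
    (by fun_prop : Continuous fun x : E n => inner ℝ x u).continuousOn
  have hh := hK.supportFn_pos hu
  have heq : inner ℝ z u = supportFn K u :=
    le_antisymm (hK.inner_le_supportFn hz u) (hK.supportFn_le_iff.2 fun x hx => hmax hx)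
  have hg : gauge K z = 1 := by
    refine le_antisymm (hK.mem_iff.1 hz) ?_
    have := hK.inner_le_gauge_mul_supportFn z u
    rw [heq] at this
    exact (le_mul_iff_one_le_left hh).1 this
  have hzf := hK.mem_frontier_iff.2 hg
  have h0 := hK.ne_zero_of_mem_frontier hzf
  refine ⟨z, hzf, ?_⟩
  rw [gradient_eq_of_touching (a := (supportFn K u)⁻¹ • u) (hK.differentiableAt_gauge h0),
    smul_inv_smul₀ hh.ne']
  · intro w
    rw [real_inner_smul_left, inv_mul_le_iff₀ hh, real_inner_comm, mul_comm]
    exact hK.inner_le_gauge_mul_supportFn w u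
  · rw [real_inner_smul_left, real_inner_comm, heq, inv_mul_cancel₀ hh.ne', hg]

theorem exists_gaussMap_eq (hK : IsC2Body K) {u : E n} (hu : ‖u‖ = 1) :
    ∃ z ∈ frontier K, gaussMap K z = u := by
  have hu0 : u ≠ 0 := by
    rintro rfl
    simp at hu
  obtain ⟨z, hz, h⟩ := hK.exists_supportFn_smul_gradient hu0
  refine ⟨z, hz, ?_⟩
  have hn : supportFn K u * ‖gradient (gauge K) z‖ = 1 := by
    have := congrArg norm h
    rwa [norm_smul, Real.norm_of_nonneg (hK.supportFn_nonneg u), hu] at this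
  rw [gaussMap, inv_eq_of_mul_eq_one_left hn, h]

end IsC2Body

namespace IsC2Plus

/-- If two boundary points had the same normal, the segment between them would lie in the boundary
and the normal would be constant along it, so that the direction of the segment would be in the
kernel of the shape operator. -/
theorem eq_of_gradient_eq (hK : IsC2Plus K) (hx : x ∈ frontier K) (hy : y ∈ frontier K)
    (h : gradient (gauge K) x = gradient (gauge K) y) : x = y := by
  have hC := hK.isC2Body
  set a := gradient (gauge K) x with ha
  have hx0 := hC.ne_zero_of_mem_frontier hx
  have hax : inner ℝ a x = 1 := by
    rw [ha, hC.inner_gradient_self hx0, hC.mem_frontier_iff.1 hx]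
  have hay : inner ℝ a y = 1 := by
    rw [h, hC.inner_gradient_self (hC.ne_zero_of_mem_frontier hy), hC.mem_frontier_iff.1 hy]
  have hseg : ∀ t : ℝ, 0 ≤ t → t ≤ 1 →
      x + t • (y - x) ∈ frontier K ∧ gradient (gauge K) (x + t • (y - x)) = a := by
    intro t ht0 ht1
    have hin : inner ℝ a (x + t • (y - x)) = 1 := by
      rw [inner_add_right, real_inner_smul_right, inner_sub_right, hax, hay]
      ring
    have hg : gauge K (x + t • (y - x)) = 1 := by
      refine le_antisymm (hC.mem_iff.1 ?_) (hin ▸ hC.inner_gradient_le hx0 _)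
      exact hK.convex.add_smul_sub_mem (hC.frontier_subset hx) (hC.frontier_subset hy) ⟨ht0, ht1⟩
    have hf := hC.mem_frontier_iff.2 hg
    exact ⟨hf, gradient_eq_of_touching
      (hC.differentiableAt_gauge (hC.ne_zero_of_mem_frontier hf))
      (hC.inner_gradient_le hx0) (hin.trans hg.symm)⟩
  -- the gradient has derivative `0` in direction `y - x` at the midpoint of the segment
  set m := x + (1 / 2 : ℝ) • (y - x) with hm
  obtain ⟨hmf, hma⟩ := hseg (1 / 2) (by norm_num) (by norm_num)
  have hm0 := hC.ne_zero_of_mem_frontier hmf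
  have hker : fderiv ℝ (gradient (gauge K)) m (y - x) = 0 := by
    have hl := (hC.differentiableAt_gradient hm0).hasFDerivAt.hasLineDerivAt (y - x)
    refine tendsto_nhds_unique hl.tendsto_slope_zero_right ?_
    refine tendsto_const_nhds.congr' ?_
    filter_upwards [Ioo_mem_nhdsGT (show (0 : ℝ) < 1 / 2 by norm_num)] with t ht
    have h1 : m + t • (y - x) = x + (1 / 2 + t) • (y - x) := by rw [hm, add_smul, add_assoc]
    rw [h1, (hseg (1 / 2 + t) (by linarith [ht.1]) (by linarith [ht.2])).2, hma, sub_self,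
      smul_zero]
  have := (hC.gaussCurvatureAt_pos_iff hm0).1 (hK.gaussCurvature_pos m hmf) (y - x)
    (by rw [hma, inner_sub_right, hax, hay, sub_self]) hker
  exact (sub_eq_zero.1 this).symm

theorem injOn_gaussMap (hK : IsC2Plus K) : Set.InjOn (gaussMap K) (frontier K) := by
  intro x hx y hy h
  have hC := hK.isC2Body
  -- the norm of the gradient at `z` is determined by the normal, as `supportFn K (∇g z) = 1`
  have key : ∀ z ∈ frontier K,
      gradient (gauge K) z = (supportFn K (gaussMap K z))⁻¹ • gaussMap K z := by
    intro z hz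
    have hz0 := hC.ne_zero_of_mem_frontier hz
    have hn := norm_ne_zero_iff.2 (hC.gradient_ne_zero hz0)
    have h1 : supportFn K (gaussMap K z) = ‖gradient (gauge K) z‖⁻¹ := by
      rw [gaussMap, hC.supportFn_smul (by positivity), hC.supportFn_gradient hz0, mul_one]
    rw [h1, gaussMap, inv_inv, smul_inv_smul₀ hn]
  exact hK.eq_of_gradient_eq hx hy (by rw [key x hx, key y hy, h])

theorem normalParam_mem (hK : IsC2Plus K) (u : S n) : normalParam K u ∈ frontier K :=
  Function.invFunOn_mem (hK.isC2Body.exists_gaussMap_eq (norm_eq_of_mem_sphere u))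

theorem gaussMap_normalParam (hK : IsC2Plus K) (u : S n) : gaussMap K (normalParam K u) = u :=
  Function.invFunOn_eq (hK.isC2Body.exists_gaussMap_eq (norm_eq_of_mem_sphere u))

/-- The Gauss map is a continuous bijection from a compact space, so its inverse is continuous. -/
theorem continuous_normalParam (hK : IsC2Plus K) : Continuous (normalParam K) := by
  have hC := hK.isC2Body
  have : CompactSpace (frontier K) := isCompact_iff_compactSpace.1 hC.isCompact_frontier
  let e : frontier K ≃ S n :=
    { toFun := fun z => ⟨gaussMap K z, by
        simpa using hC.norm_gaussMap (hC.ne_zero_of_mem_frontier z.2)⟩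
      invFun := fun u => ⟨normalParam K u, hK.normalParam_mem u⟩
      left_inv := fun z => Subtype.ext <|
        hK.injOn_gaussMap (hK.normalParam_mem _) z.2 (hK.gaussMap_normalParam _)
      right_inv := fun u => Subtype.ext (hK.gaussMap_normalParam u) }
  have he : Continuous e := by
    refine Continuous.subtype_mk (continuous_iff_continuousAt.2 fun z => ?_) _
    exact (hC.contDiffAt_gaussMap (hC.ne_zero_of_mem_frontier z.2)).continuousAt.comp
      continuous_subtype_val.continuousAt
  exact continuous_subtype_val.comp (he.homeoOfEquivCompactToT2).symm.continuous

theorem gaussCurvature_pos' (hK : IsC2Plus K) (u : S n) : 0 < gaussCurvature K u :=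
  hK.gaussCurvature_pos _ (hK.normalParam_mem u)

theorem continuous_gaussCurvature (hK : IsC2Plus K) : Continuous (gaussCurvature K) :=
  continuous_iff_continuousAt.2 fun u =>
    (hK.isC2Body.continuousAt_gaussCurvatureAt
      (hK.isC2Body.ne_zero_of_mem_frontier (hK.normalParam_mem u))).comp
      hK.continuous_normalParam.continuousAt

end IsC2Plus

/-! ### Polarity of `C²₊` bodies -/

namespace IsC2Body

theorem fderiv_gradient_smul (hK : IsC2Body K) (hx : x ≠ 0) {c : ℝ} (hc : 0 < c) (v : E n) :
    fderiv ℝ (gradient (gauge K)) (c • x) (c • v) = fderiv ℝ (gradient (gauge K)) x v := by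
  have h1 : HasFDerivAt (fun z => gradient (gauge K) (c • z))
      ((fderiv ℝ (gradient (gauge K)) (c • x)).comp (c • ContinuousLinearMap.id ℝ (E n))) x :=
    (hK.differentiableAt_gradient (smul_ne_zero hc.ne' hx)).hasFDerivAt.comp x
      ((hasFDerivAt_id x).const_smul c)
  have h2 : (fun z => gradient (gauge K) (c • z)) =ᶠ[𝓝 x] gradient (gauge K) := by
    filter_upwards [isOpen_compl_singleton.mem_nhds hx] with z hz using hK.gradient_smul hz hc
  have h3 := (h2.hasFDerivAt_iff.1 h1).fderiv
  rw [h3]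
  simp

theorem convex_polarBody : Convex ℝ (polarBody K) := by
  intro y hy z hz s t hs ht hst x hx
  have h1 : inner ℝ x y ≤ 1 := hy x hx
  have h2 : inner ℝ x z ≤ 1 := hz x hx
  rw [inner_add_right, real_inner_smul_right, real_inner_smul_right]
  nlinarith

theorem isClosed_polarBody : IsClosed (polarBody K) := by
  have : polarBody K = ⋂ x ∈ K, {y | inner ℝ x y ≤ 1} := by
    ext y
    simp [polarBody]
  rw [this]
  exact isClosed_biInter fun x _ => isClosed_le (by fun_prop) continuous_const

theorem isCompact_polarBody (hK : IsC2Body K) : IsCompact (polarBody K) := by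
  obtain ⟨r, hr, hrK⟩ := Metric.nhds_basis_closedBall.mem_iff.1 hK.mem_nhds_zero
  refine (isCompact_closedBall (0 : E n) r⁻¹).of_isClosed_subset isClosed_polarBody fun y hy => ?_
  rw [mem_closedBall_zero_iff]
  rcases eq_or_ne y 0 with rfl | hy0
  · simpa using hr.le
  have hn : 0 < ‖y‖ := norm_pos_iff.2 hy0
  have hmem : (r / ‖y‖) • y ∈ K := hrK <| by
    rw [mem_closedBall_zero_iff, norm_smul, Real.norm_of_nonneg (by positivity),
      div_mul_cancel₀ _ hn.ne']
  have h1 : inner ℝ ((r / ‖y‖) • y) y ≤ 1 := hy _ hmem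
  rw [real_inner_smul_left, real_inner_self_eq_norm_sq] at h1
  rw [le_inv_comm₀ hn hr, ← one_div, le_div_iff₀ hn]
  calc r * ‖y‖ = r / ‖y‖ * ‖y‖ ^ 2 := by field_simp
    _ ≤ 1 := h1

theorem zero_mem_interior_polarBody (hK : IsC2Body K) : (0 : E n) ∈ interior (polarBody K) := by
  obtain ⟨R, hR, hKR⟩ := hK.isCompact.isBounded.exists_pos_norm_le
  refine mem_interior_iff_mem_nhds.2
    (mem_of_superset (Metric.closedBall_mem_nhds 0 (inv_pos.2 hR)) fun y hy x hx => ?_)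
  rw [mem_closedBall_zero_iff] at hy
  calc inner ℝ x y ≤ ‖x‖ * ‖y‖ := real_inner_le_norm x y
    _ ≤ R * R⁻¹ := mul_le_mul (hKR x hx) hy (norm_nonneg y) hR.le
    _ = 1 := mul_inv_cancel₀ hR.ne'

/-- Bipolar theorem. The functional separating a point from `K` is the gradient of the gauge. -/
theorem polarBody_polarBody (hK : IsC2Body K) : polarBody (polarBody K) = K := by
  refine Set.Subset.antisymm (fun z hz => ?_) fun z hz y hy => ?_
  · rcases eq_or_ne z 0 with rfl | hz0
    · exact hK.zero_mem
    have h1 := hz _ (hK.mem_polarBody_iff.2 (hK.supportFn_gradient hz0).le)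
    rwa [hK.inner_gradient_self hz0, ← hK.mem_iff] at h1
  · rw [real_inner_comm]
    exact hy z hz

end IsC2Body

namespace IsC2Plus

theorem eq_zero_of_hessian (hK : IsC2Plus K) (hx : x ≠ 0)
    (hv : inner ℝ (gradient (gauge K) x) v = 0)
    (hv' : fderiv ℝ (gradient (gauge K)) x v = 0) : v = 0 := by
  have hC := hK.isC2Body
  have hc := inv_pos.2 (hC.gauge_pos hx)
  have hf := hC.inv_gauge_smul_mem_frontier hx
  have h := (hC.gaussCurvatureAt_pos_iff (hC.ne_zero_of_mem_frontier hf)).1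
    (hK.gaussCurvature_pos _ hf) ((gauge K x)⁻¹ • v)
    (by rw [hC.gradient_smul hx hc, real_inner_smul_right, hv, mul_zero])
    (by rw [hC.fderiv_gradient_smul hx hc, hv'])
  exact (smul_eq_zero.1 h).resolve_left hc.ne'

end IsC2Plus

/-- The duality map `x ↦ g(x) ∇g(x)`, the gradient of `g² / 2` for the gauge `g` of `K`. The Legendre
dual of `g² / 2` is `h² / 2` for the support function `h` of `K`, so that the duality map of `K°` is
the inverse of this one. -/
noncomputable def dualityMap (K : Set (E n)) (x : E n) : E n :=
  gauge K x • gradient (gauge K) x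

theorem IsC2Body.contDiffAt_dualityMap (hK : IsC2Body K) (hx : x ≠ 0) :
    ContDiffAt ℝ 1 (dualityMap K) x :=
  ((hK.contDiffAt_gauge hx).of_le (by norm_num)).smul (hK.contDiffAt_gradient hx)

theorem IsC2Body.fderiv_dualityMap (hK : IsC2Body K) (hx : x ≠ 0) (v : E n) :
    fderiv ℝ (dualityMap K) x v = gauge K x • fderiv ℝ (gradient (gauge K)) x v +
      inner ℝ (gradient (gauge K) x) v • gradient (gauge K) x := by
  have h : HasFDerivAt (dualityMap K) _ x := (hK.differentiableAt_gauge hx).hasFDerivAt.smul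
    (hK.differentiableAt_gradient hx).hasFDerivAt
  rw [h.fderiv, inner_gradient_left]
  simp

theorem IsC2Body.supportFn_dualityMap (hK : IsC2Body K) (hx : x ≠ 0) :
    supportFn K (dualityMap K x) = gauge K x := by
  rw [dualityMap, hK.supportFn_smul (gauge_nonneg x), hK.supportFn_gradient hx, mul_one]

theorem IsC2Body.exists_dualityMap_eq (hK : IsC2Body K) (hy : y ≠ 0) :
    ∃ x ≠ 0, dualityMap K x = y := by
  obtain ⟨z, hz, h⟩ := hK.exists_supportFn_smul_gradient hy
  have hh := hK.supportFn_pos hy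
  have hz0 := hK.ne_zero_of_mem_frontier hz
  refine ⟨supportFn K y • z, smul_ne_zero hh.ne' hz0, ?_⟩
  rw [dualityMap, gauge_smul hh.le, hK.mem_frontier_iff.1 hz, mul_one, hK.gradient_smul hz0 hh, h]

theorem IsC2Plus.injective_fderiv_dualityMap (hK : IsC2Plus K) (hx : x ≠ 0) :
    Function.Injective (fderiv ℝ (dualityMap K) x) := by
  have hC := hK.isC2Body
  have hg := hC.gauge_pos hx
  refine (injective_iff_map_eq_zero _).2 fun v hv => ?_
  rw [hC.fderiv_dualityMap hx] at hv
  -- pairing with `x` isolates the component along the gradient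
  have h1 : inner ℝ (gradient (gauge K) x) v = 0 := by
    have := congrArg (inner ℝ x) hv
    rw [inner_add_right, real_inner_smul_right, hC.inner_fderiv_gradient_self_left hx,
      real_inner_smul_right, inner_zero_right, real_inner_comm _ x, hC.inner_gradient_self hx,
      mul_zero, zero_add] at this
    exact (mul_eq_zero.1 this).resolve_right hg.ne'
  rw [h1, zero_smul, add_zero] at hv
  exact hK.eq_zero_of_hessian hx h1 ((smul_eq_zero.1 hv).resolve_left hg.ne')

/-- The inverse function theorem for the duality map. -/
theorem IsC2Plus.exists_local_dualityMap_rightInverse (hK : IsC2Plus K) (hy : y ≠ 0) :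
    ∃ φ : E n → E n, ContDiffAt ℝ 1 φ y ∧ ∀ᶠ w in 𝓝 y, φ w ≠ 0 ∧ dualityMap K (φ w) = w := by
  have hC := hK.isC2Body
  obtain ⟨x, hx, rfl⟩ := hC.exists_dualityMap_eq hy
  have hT := hC.contDiffAt_dualityMap hx
  let e : E n ≃L[ℝ] E n := (LinearEquiv.ofInjectiveEndo
    (fderiv ℝ (dualityMap K) x).toLinearMap
    (hK.injective_fderiv_dualityMap hx)).toContinuousLinearEquiv
  have he : HasFDerivAt (dualityMap K) (e : E n →L[ℝ] E n) x := by
    have : (e : E n →L[ℝ] E n) = fderiv ℝ (dualityMap K) x := by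
      ext1 v
      rfl
    rw [this]
    exact (hT.differentiableAt (by norm_num)).hasFDerivAt
  have hφ := hT.to_localInverse he (by norm_num)
  refine ⟨_, hφ, ?_⟩
  have h1 := (hT.hasStrictFDerivAt' he (by norm_num)).eventually_right_inverse
  have h2 := hφ.continuousAt.eventually_ne
    (show hT.localInverse he (by norm_num) (dualityMap K x) ≠ 0 by
      rwa [hT.localInverse_apply_image])
  filter_upwards [h1, h2] with w hw hw' using ⟨hw', hw⟩

/-- Where `φ` is an inverse of the duality map, `supportFn K = gauge K ∘ φ`, and the gradient of
`supportFn K` is the point `(gauge K (φ w))⁻¹ • φ w` of the boundary. -/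
theorem IsC2Body.gradient_supportFn (hK : IsC2Body K) {φ : E n → E n}
    (hφ : DifferentiableAt ℝ φ y) (hinv : ∀ᶠ w in 𝓝 y, φ w ≠ 0 ∧ dualityMap K (φ w) = w) :
    DifferentiableAt ℝ (supportFn K) y ∧
      gradient (supportFn K) y = (gauge K (φ y))⁻¹ • φ y := by
  obtain ⟨h0, hy⟩ := hinv.self_of_nhds
  have hg := hK.gauge_pos h0
  have hd : DifferentiableAt ℝ (supportFn K) y := by
    refine ((hK.differentiableAt_gauge h0).comp y hφ).congr_of_eventuallyEq ?_
    filter_upwards [hinv] with w hw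
    rw [Function.comp_apply, ← hK.supportFn_dualityMap hw.1, hw.2]
  refine ⟨hd, gradient_eq_of_touching hd (fun w => ?_) ?_⟩
  · rw [real_inner_smul_left, inv_mul_le_iff₀ hg]
    exact hK.inner_le_gauge_mul_supportFn _ w
  · have hs : inner ℝ ((gauge K (φ y))⁻¹ • φ y) (dualityMap K (φ y)) =
        supportFn K (dualityMap K (φ y)) := by
      rw [hK.supportFn_dualityMap h0, dualityMap, real_inner_smul_left, real_inner_smul_right,
        real_inner_comm, hK.inner_gradient_self h0, inv_mul_cancel_left₀ hg.ne']
    rwa [hy] at hs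

theorem IsC2Plus.contDiffAt_supportFn (hK : IsC2Plus K) (hy : y ≠ 0) :
    ContDiffAt ℝ 2 (supportFn K) y := by
  have hC := hK.isC2Body
  obtain ⟨φ, hφ, hinv⟩ := hK.exists_local_dualityMap_rightInverse hy
  have hφd : ∀ᶠ w in 𝓝 y, DifferentiableAt ℝ φ w :=
    (hφ.eventually (by simp)).mono fun w hw => hw.differentiableAt (by norm_num)
  have hloc : ∀ᶠ w in 𝓝 y, HasFDerivAt (supportFn K)
      (InnerProductSpace.toDual ℝ (E n) ((gauge K (φ w))⁻¹ • φ w)) w := by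
    filter_upwards [hφd, hinv.eventually_nhds] with w hw hw'
    obtain ⟨h1, h2⟩ := hC.gradient_supportFn hw hw'
    rw [← h2, toDual_gradient]
    exact h1.hasFDerivAt
  have hC1 : ContDiffAt ℝ 1
      (fun w => InnerProductSpace.toDual ℝ (E n) ((gauge K (φ w))⁻¹ • φ w)) y := by
    have h0 := hinv.self_of_nhds.1
    have h1 : ContDiffAt ℝ 1 (fun w => gauge K (φ w)) y :=
      ((hC.contDiffAt_gauge h0).of_le (by norm_num)).comp y hφ
    exact (InnerProductSpace.toDual ℝ (E n)).contDiff.contDiffAt.comp y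
      ((h1.inv (hC.gauge_pos h0).ne').smul hφ)
  have := (contDiffAt_succ_iff_hasFDerivAt (n := 1) (f := supportFn K) (x := y) (𝕜 := ℝ)).2
    ⟨_, hloc.exists_mem.imp fun s hs => hs, hC1⟩
  simpa [one_add_one_eq_two] using this

theorem IsC2Plus.isC2Body_polarBody (hK : IsC2Plus K) : IsC2Body (polarBody K) where
  convex := IsC2Body.convex_polarBody
  isCompact := hK.isC2Body.isCompact_polarBody
  zero_mem_interior := hK.isC2Body.zero_mem_interior_polarBody
  contDiffOn_gauge := fun y hy => by
    rw [hK.isC2Body.gauge_polarBody]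
    exact (hK.contDiffAt_supportFn hy).contDiffWithinAt

/-- The class `C²₊` is closed under polarity: the duality map of `K°` is inverse to the one of `K`,
so that its derivative is injective. -/
theorem IsC2Plus.isC2Plus_polarBody (hK : IsC2Plus K) : IsC2Plus (polarBody K) := by
  have hC := hK.isC2Body
  have hP := hK.isC2Body_polarBody
  refine ⟨hP.convex, hP.isCompact, hP.zero_mem_interior, hP.contDiffOn_gauge, fun y hy => ?_⟩
  have hy0 := hP.ne_zero_of_mem_frontier hy
  refine (hP.gaussCurvatureAt_pos_iff hy0).2 fun v hv hv' => ?_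
  obtain ⟨φ, hφ, hinv⟩ := hK.exists_local_dualityMap_rightInverse hy0
  have hφd : ∀ᶠ w in 𝓝 y, DifferentiableAt ℝ φ w :=
    (hφ.eventually (by simp)).mono fun w hw => hw.differentiableAt (by norm_num)
  have heq : dualityMap (polarBody K) =ᶠ[𝓝 y] φ := by
    filter_upwards [hφd, hinv.eventually_nhds] with w hw hw'
    obtain ⟨h0, h1⟩ := hw'.self_of_nhds
    rw [dualityMap, hC.gauge_polarBody, (hC.gradient_supportFn hw hw').2]
    nth_rw 1 [← h1]
    rw [hC.supportFn_dualityMap h0, smul_inv_smul₀ (hC.gauge_pos h0).ne']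
  have hφv : fderiv ℝ φ y v = 0 := by
    rw [← heq.fderiv_eq, hP.fderiv_dualityMap hy0, hv, hv', smul_zero, zero_smul, add_zero]
  have hid : HasFDerivAt (fun w => dualityMap K (φ w)) (ContinuousLinearMap.id ℝ (E n)) y :=
    (hasFDerivAt_id y).congr_of_eventuallyEq (hinv.mono fun w hw => hw.2)
  have hcomp := ((hC.contDiffAt_dualityMap hinv.self_of_nhds.1).differentiableAt
    (by norm_num)).hasFDerivAt.comp y hφd.self_of_nhds.hasFDerivAt
  have := congrArg (fun f => f v) (hid.unique hcomp)
  simpa [hφv] using this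

/-! ### Moments of the centro-affine curvature -/

theorem IsC2Body.continuous_supportFn (hK : IsC2Body K) : Continuous (supportFn K) := by
  rw [← hK.gauge_polarBody]
  exact _root_.continuous_gauge IsC2Body.convex_polarBody
    (mem_interior_iff_mem_nhds.1 hK.zero_mem_interior_polarBody)

theorem IsC2Body.supportFn_sphere_pos (hK : IsC2Body K) (u : S n) : 0 < supportFn K (u : E n) :=
  hK.supportFn_pos (ne_zero_of_mem_unit_sphere u)

theorem IsC2Body.continuous_supportFn_sphere (hK : IsC2Body K) :
    Continuous fun u : S n => supportFn K (u : E n) :=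
  hK.continuous_supportFn.comp continuous_subtype_val

/-- The interior of the polar body is star-shaped with radial function `1 / h` in polar
coordinates, and its boundary is a null set. -/
theorem IsC2Body.volume_polarBody (hK : IsC2Body K) (hn : 1 ≤ n) :
    volume (polarBody K) = ∫⁻ u : S n, ENNReal.ofReal ((supportFn K (u : E n) ^ n)⁻¹ / n)
      ∂(volume : Measure (E n)).toSphere := by
  have : Nonempty (Fin n) := ⟨⟨0, hn⟩⟩
  set A : Set (E n) := {y | supportFn K y < 1} with hA
  have hAo : IsOpen A := isOpen_lt hK.continuous_supportFn continuous_const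
  have hAint : A = interior (polarBody K) := by
    rw [hA, ← hK.gauge_polarBody, setOfPred_gauge_lt_one_eq_interior convex_polarBody
      (mem_interior_iff_mem_nhds.1 hK.zero_mem_interior_polarBody)]
  have h1 : volume (polarBody K) = volume A := by
    rw [hAint]
    exact (measure_congr (interior_ae_eq_of_null_frontier
      (convex_polarBody.addHaar_frontier volume))).symm
  have h2 : volume A = (Measure.comap ((↑) : ({0}ᶜ : Set (E n)) → E n) volume)
      ((↑) ⁻¹' A) := by
    rw [Measure.comap_apply _ Subtype.val_injective (fun s hs =>
      (measurableSet_singleton (0 : E n)).compl.subtype_image hs) _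
      (hAo.measurableSet.preimage measurable_subtype_coe), Subtype.image_preimage_coe,
      Set.inter_comm, ← Set.sdiff_eq, measure_sdiff_null (measure_singleton _)]
  -- `A` in polar coordinates
  set B : Set (S n × Set.Ioi (0 : ℝ)) := {p | (p.2 : ℝ) < (supportFn K (p.1 : E n))⁻¹} with hB
  have hBm : MeasurableSet B := by
    refine (isOpen_lt (by fun_prop) ?_).measurableSet
    exact (hK.continuous_supportFn_sphere.comp continuous_fst).inv₀
      fun p => (hK.supportFn_sphere_pos p.1).ne'
  have h3 : ((↑) ⁻¹' A : Set ({0}ᶜ : Set (E n))) = homeomorphUnitSphereProd (E n) ⁻¹' B := by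
    ext x
    have hx : 0 < ‖(x : E n)‖ := norm_pos_iff.2 x.2
    simp only [hA, hB, Set.mem_preimage, Set.mem_ofPred_eq, homeomorphUnitSphereProd_apply_fst_coe,
      homeomorphUnitSphereProd_apply_snd_coe]
    rw [hK.supportFn_smul (by positivity), mul_inv, inv_inv, lt_mul_iff_one_lt_right hx,
      one_lt_inv₀ (hK.supportFn_pos x.2)]
  have hmp := (volume : Measure (E n)).measurePreserving_homeomorphUnitSphereProd
  rw [h1, h2, h3, hmp.measure_preimage hBm.nullMeasurableSet, Measure.prod_apply hBm]
  refine lintegral_congr fun u => ?_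
  have h4 : Prod.mk u ⁻¹' B =
      Set.Iio ⟨(supportFn K (u : E n))⁻¹, inv_pos.2 (hK.supportFn_sphere_pos u)⟩ := by
    ext r
    rfl
  rw [h4, Measure.volumeIoiPow_apply_Iio, finrank_euclideanSpace_fin]
  congr 2
  · rw [Nat.sub_add_cancel hn, inv_pow]
  · exact_mod_cast Nat.sub_add_cancel hn

theorem IsC2Body.integral_supportFn (hK : IsC2Body K) (hn : 1 ≤ n) :
    ∫ u : S n, (supportFn K (u : E n) ^ n)⁻¹ ∂(volume : Measure (E n)).toSphere =
      n * vol (polarBody K) := by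
  have hn0 : (n : ℝ) ≠ 0 := by positivity
  rw [vol, hK.volume_polarBody hn, ← integral_eq_lintegral_of_nonneg_ae, integral_div,
    mul_div_cancel₀ _ hn0]
  · exact Eventually.of_forall fun u =>
      div_nonneg (inv_nonneg.2 (pow_nonneg (hK.supportFn_nonneg _) n)) n.cast_nonneg
  · refine Continuous.aestronglyMeasurable ?_
    exact ((hK.continuous_supportFn_sphere.pow n).inv₀
      fun u => (pow_pos (hK.supportFn_sphere_pos u) n).ne').div_const _

theorem IsC2Body.vol_polarBody_pos (hK : IsC2Body K) : 0 < vol (polarBody K) := by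
  refine ENNReal.toReal_pos ?_ hK.isCompact_polarBody.measure_lt_top.ne
  exact (Measure.measure_pos_of_mem_nhds volume
    (mem_interior_iff_mem_nhds.1 hK.zero_mem_interior_polarBody)).ne'

theorem IsC2Plus.centroAffineCurvature_pos (hK : IsC2Plus K) (u : S n) :
    0 < centroAffineCurvature K u :=
  div_pos (hK.gaussCurvature_pos' u) (pow_pos (hK.isC2Body.supportFn_sphere_pos u) _)

theorem IsC2Plus.continuous_centroAffineCurvature (hK : IsC2Plus K) :
    Continuous (centroAffineCurvature K) :=
  hK.continuous_gaussCurvature.div (hK.isC2Body.continuous_supportFn_sphere.pow _)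
    fun u => (pow_pos (hK.isC2Body.supportFn_sphere_pos u) _).ne'

/-- Since `κ₀ dμ_K = h⁻ⁿ dσ` is the cone measure of the polar body up to reparametrization, the
affine surface area is a moment of `κ₀` with respect to it. -/
theorem IsC2Plus.affineSurfaceArea_eq (hK : IsC2Plus K) {p : ℝ} (hp : (n : ℝ) + p ≠ 0) :
    affineSurfaceArea p K = ∫ u : S n, centroAffineCurvature K u ^ (-(n / ((n : ℝ) + p))) *
      (supportFn K (u : E n) ^ n)⁻¹ ∂(volume : Measure (E n)).toSphere := by
  have hdens : Measurable fun u : S n => (supportFn K (u : E n) / gaussCurvature K u).toNNReal :=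
    (hK.isC2Body.continuous_supportFn_sphere.div hK.continuous_gaussCurvature
      fun u => (hK.gaussCurvature_pos' u).ne').measurable.real_toNNReal
  rw [affineSurfaceArea, coneMeasure]
  simp only [ENNReal.ofReal]
  rw [integral_withDensity_eq_integral_smul hdens]
  refine integral_congr_ae (Eventually.of_forall fun u => ?_)
  have hκ := hK.gaussCurvature_pos' u
  have hh := hK.isC2Body.supportFn_sphere_pos u
  have hexp : p / ((n : ℝ) + p) = -(n / ((n : ℝ) + p)) + 1 := by
    field_simp
    ring
  simp only [NNReal.smul_def, smul_eq_mul]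
  rw [Real.coe_toNNReal _ (div_pos hh hκ).le, hexp,
    Real.rpow_add_one (hK.centroAffineCurvature_pos u).ne', mul_comm, mul_assoc]
  congr 1
  rw [centroAffineCurvature]
  field_simp
  ring

/-- The moments of a positive continuous function are differentiable in the exponent. -/
theorem hasDerivAt_integral_rpow_mul {X : Type*} [TopologicalSpace X] [CompactSpace X]
    [MeasurableSpace X] [OpensMeasurableSpace X] {μ : Measure X} [IsFiniteMeasure μ]
    {f w : X → ℝ} (hf : Continuous f) (hf0 : ∀ x, 0 < f x) (hw : Continuous w) :
    HasDerivAt (fun s : ℝ => ∫ x, f x ^ s * w x ∂μ) (∫ x, Real.log (f x) * w x ∂μ) 0 := by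
  have hc : Continuous fun q : ℝ × X => f q.2 ^ q.1 * Real.log (f q.2) * w q.2 :=
    (((hf.comp continuous_snd).rpow continuous_fst fun q => Or.inl (hf0 q.2).ne').mul
      ((hf.comp continuous_snd).log fun q => (hf0 q.2).ne')).mul (hw.comp continuous_snd)
  obtain ⟨C, hC⟩ := ((isCompact_closedBall (0 : ℝ) 1).prod
    (isCompact_univ (X := X))).exists_bound_of_continuousOn hc.continuousOn
  have hcont : ∀ s : ℝ, Continuous fun x => f x ^ s * w x := fun s =>
    (hf.rpow_const fun x => Or.inl (hf0 x).ne').mul hw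
  have hint : Integrable (fun x => f x ^ (0 : ℝ) * w x) μ := by
    obtain ⟨D, hD⟩ := (isCompact_univ (X := X)).exists_bound_of_continuousOn
      (hcont 0).continuousOn
    exact Integrable.of_bound (hcont 0).aestronglyMeasurable D
      (Eventually.of_forall fun x => hD x trivial)
  have := (hasDerivAt_integral_of_dominated_loc_of_deriv_le (μ := μ) (x₀ := (0 : ℝ))
    (F := fun s x => f x ^ s * w x) (F' := fun s x => f x ^ s * Real.log (f x) * w x)
    (bound := fun _ => C) (Metric.ball_mem_nhds 0 one_pos)
    (Eventually.of_forall fun s => (hcont s).aestronglyMeasurable) hint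
    (hc.comp (Continuous.prodMk_right 0)).aestronglyMeasurable
    (Eventually.of_forall fun x s hs => hC (s, x) ⟨Metric.ball_subset_closedBall hs, trivial⟩)
    (integrable_const C)
    (Eventually.of_forall fun x s _ =>
      ((Real.hasStrictDerivAt_const_rpow (hf0 x) s).hasDerivAt).mul_const (w x))).2
  simpa using this

theorem tendsto_rpow_inv_of_hasDerivAt {ψ : ℝ → ℝ} {d : ℝ} (hψ : HasDerivAt ψ d 0)
    (h0 : ψ 0 = 1) : Tendsto (fun s => ψ s ^ s⁻¹) (𝓝[≠] 0) (𝓝 (Real.exp d)) := by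
  have hpos : ∀ᶠ s in 𝓝 0, 0 < ψ s := hψ.continuousAt.eventually_const_lt (by simp [h0])
  have hlog := (hψ.log (by simp [h0])).tendsto_slope_zero
  simp only [zero_add, h0, Real.log_one, sub_zero, div_one, smul_eq_mul] at hlog
  refine ((Real.continuous_exp.tendsto d).comp hlog).congr' ?_
  filter_upwards [nhdsWithin_le_nhds hpos] with s hs
  rw [Function.comp_apply, Real.rpow_def_of_pos hs, mul_comm]

/-- Both sequences are powers of `ψ s ^ s⁻¹`, where `ψ s` is the normalized moment of order `s` of
the centro-affine curvature, along `s = -n / (n + p)` and `s = n / 2 ^ p` respectively. -/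
theorem IsC2Plus.exists_tendsto_paourisWernerSeq (hK : IsC2Plus K) (hn : 1 ≤ n) :
    ∃ L : ℝ, 0 < L ∧ Tendsto (paourisWernerSeq K) atTop (𝓝 L) ∧
      Tendsto (fun p : ℕ => (affineSurfaceArea (-((n : ℝ) + 2 ^ p)) K /
        ((n : ℝ) * vol (polarBody K))) ^ (2 ^ p)) atTop (𝓝 L⁻¹) := by
  have hC := hK.isC2Body
  have hn0 : (0 : ℝ) < n := by exact_mod_cast hn
  set V : ℝ := n * vol (polarBody K) with hV
  have hVpos : 0 < V := mul_pos hn0 hC.vol_polarBody_pos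
  set ψ : ℝ → ℝ := fun s => (∫ u : S n, centroAffineCurvature K u ^ s *
    (supportFn K (u : E n) ^ n)⁻¹ ∂(volume : Measure (E n)).toSphere) / V with hψ
  have hψ0 : ψ 0 = 1 := by
    simp only [hψ, Real.rpow_zero, one_mul]
    rw [hC.integral_supportFn hn, div_self hVpos.ne']
  have hψnn : ∀ s, 0 ≤ ψ s := fun s => div_nonneg (integral_nonneg fun u =>
    mul_nonneg (Real.rpow_nonneg (hK.centroAffineCurvature_pos u).le s)
      (inv_nonneg.2 (pow_nonneg (hC.supportFn_nonneg _) n))) hVpos.le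
  have hw : Continuous fun u : S n => (supportFn K (u : E n) ^ n)⁻¹ :=
    (hC.continuous_supportFn_sphere.pow n).inv₀
      fun u => (pow_pos (hC.supportFn_sphere_pos u) n).ne'
  have hder := (hasDerivAt_integral_rpow_mul (μ := (volume : Measure (E n)).toSphere)
    hK.continuous_centroAffineCurvature hK.centroAffineCurvature_pos hw).div_const V
  have hlim := tendsto_rpow_inv_of_hasDerivAt (ψ := ψ) hder hψ0
  set ℓ := Real.exp ((∫ u : S n, Real.log (centroAffineCurvature K u) *
    (supportFn K (u : E n) ^ n)⁻¹ ∂(volume : Measure (E n)).toSphere) / V) with hℓ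
  have hℓpos : 0 < ℓ := Real.exp_pos _
  have hΩ : ∀ p : ℝ, (n : ℝ) + p ≠ 0 → affineSurfaceArea p K / V = ψ (-(n / ((n : ℝ) + p))) :=
    fun p hp => by rw [hK.affineSurfaceArea_eq hp]
  refine ⟨ℓ ^ (-(n : ℝ)), Real.rpow_pos_of_pos hℓpos _, ?_, ?_⟩
  · have hs : Tendsto (fun p : ℝ => -(n / ((n : ℝ) + p))) atTop (𝓝[≠] 0) := by
      refine tendsto_nhdsWithin_iff.2 ⟨?_, ?_⟩
      · simpa using ((tendsto_atTop_add_const_left atTop (n : ℝ) tendsto_id).const_div_atTop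
          (n : ℝ)).neg
      · filter_upwards [eventually_gt_atTop 0] with p hp
        exact neg_ne_zero.2 (by positivity)
    refine ((hlim.comp hs).rpow_const (p := -(n : ℝ)) (Or.inl hℓpos.ne')).congr' ?_
    filter_upwards [eventually_gt_atTop 0] with p hp
    have hq : 0 < (n : ℝ) + p := by positivity
    rw [paourisWernerSeq, hΩ p hq.ne', Function.comp_apply, ← Real.rpow_mul (hψnn _)]
    congr 1
    field_simp
  · have hs : Tendsto (fun p : ℕ => (n : ℝ) / 2 ^ p) atTop (𝓝[≠] 0) := by
      refine tendsto_nhdsWithin_iff.2 ⟨?_, Eventually.of_forall fun p => ?_⟩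
      · exact (tendsto_pow_atTop_atTop_of_one_lt one_lt_two).const_div_atTop _
      · exact (by positivity : (n : ℝ) / 2 ^ p ≠ 0)
    rw [Real.rpow_neg hℓpos.le, inv_inv]
    refine ((hlim.comp hs).rpow_const (p := (n : ℝ)) (Or.inl hℓpos.ne')).congr fun p => ?_
    have h2 : (n : ℝ) + -((n : ℝ) + 2 ^ p) = -2 ^ p := by ring
    have h3 : (2 : ℝ) ^ p = ((2 ^ p : ℕ) : ℝ) := by norm_num
    rw [hΩ _ (by rw [h2]; simp), h2, div_neg, neg_neg, Function.comp_apply,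
      ← Real.rpow_mul (hψnn _), inv_div, div_mul_cancel₀ _ hn0.ne', h3, Real.rpow_natCast]

end AffineInvariants

theorem mainTheorem9 (n : ℕ) (hn : 2 ≤ n) (K : Set (AffineInvariants.E n))
    (hK : AffineInvariants.IsC2Plus K) :
    -- the limits defining `Ω_K` and `Ω_{K°}` exist and are positive
    (Tendsto (AffineInvariants.paourisWernerSeq K) atTop (𝓝 (AffineInvariants.paourisWerner K)) ∧
      0 < AffineInvariants.paourisWerner K) ∧
    (Tendsto (AffineInvariants.paourisWernerSeq (AffineInvariants.polarBody K)) atTop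
        (𝓝 (AffineInvariants.paourisWerner (AffineInvariants.polarBody K))) ∧
      0 < AffineInvariants.paourisWerner (AffineInvariants.polarBody K)) ∧
    -- the sequence for `K` converges to `Ω_K⁻¹`
    Tendsto (fun p : ℕ =>
        (AffineInvariants.affineSurfaceArea (-((n : ℝ) + 2 ^ p)) K /
          ((n : ℝ) * AffineInvariants.vol (AffineInvariants.polarBody K))) ^ (2 ^ p))
      atTop (𝓝 (AffineInvariants.paourisWerner K)⁻¹) ∧
    -- the sequence for `K°` converges to `Ω_{K°}⁻¹`
    Tendsto (fun p : ℕ =>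
        (AffineInvariants.affineSurfaceArea (-((n : ℝ) + 2 ^ p)) (AffineInvariants.polarBody K) /
          ((n : ℝ) * AffineInvariants.vol K)) ^ (2 ^ p))
      atTop (𝓝 (AffineInvariants.paourisWerner (AffineInvariants.polarBody K))⁻¹) := by
  have hn1 : 1 ≤ n := by omega
  obtain ⟨L, hL, h1, h2⟩ := hK.exists_tendsto_paourisWernerSeq hn1
  obtain ⟨M, hM, h3, h4⟩ := hK.isC2Plus_polarBody.exists_tendsto_paourisWernerSeq hn1
  rw [hK.isC2Body.polarBody_polarBody] at h4
  have hL' : AffineInvariants.paourisWerner K = L := h1.limUnder_eq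
  have hM' : AffineInvariants.paourisWerner (AffineInvariants.polarBody K) = M := h3.limUnder_eq
  rw [hL', hM']
  exact ⟨⟨h1, hL⟩, ⟨h3, hM⟩, h2, h4⟩
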